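/- For integers $d\ge 1$ and $l_1,\dots,l_d\ge 1$ with $l_d\ge 2$, let $$\zeta(l_1,\dots,l_d)=\sum_{0<n_1<n_2<\cdots<n_d}\frac{1}{n_1^{l_1}n_2^{l_2}\cdots n_d^{l_d}}$$ be the multiple zeta value of weight $l_1+\cdots+l_d$ and depth $d$, and let the algebra of multiple zeta values be the $\mathbb{Q}$-subalgebra of $\mathbb{R}$ generated by all of these numbers. Let $r,s\ge 1$ and $k_1,\dots,k_s\ge 1$ be integers. Then the series $$\sum_{n_1,n_2,\dots,n_s\ge 1}\frac{1}{n_1^{k_1}n_2^{k_2}\cdots n_s^{k_s}\,(n_1+n_2+\cdots+n_s)^r}$$ converges, and its value lies in the algebra of multiple zeta values. More precisely, its value is a $\mathbb{Q}$-linear combination of multiple zeta values of weight $k_1+k_2+\cdots+k_s+r$ and depth $s$. -/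

import Mathlib

open scoped BigOperators

/-- An index `(k₁, …, k_d)` is admissible if `d ≥ 1`, all `k_i ≥ 1`, and the last entry
satisfies `k_d ≥ 2`. -/
def IsAdmissible {d : ℕ} (k : Fin d → ℕ) : Prop :=
  (∀ i, 1 ≤ k i) ∧ ∃ i : Fin d, (i : ℕ) + 1 = d ∧ 2 ≤ k i

/-- The multiple zeta value
`ζ(k₁, …, k_d) = ∑_{0 < n₁ < ⋯ < n_d} 1 / (n₁ ^ k₁ ⋯ n_d ^ k_d)`
(the series converges for admissible indices, the only ones used below). -/
noncomputable def multipleZeta {d : ℕ} (k : Fin d → ℕ) : ℝ :=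
  ∑' n : {n : Fin d → ℕ+ // StrictMono n}, 1 / ∏ i, ((n.1 i : ℕ) : ℝ) ^ k i

/-- The set of all multiple zeta values. -/
def mzvSet : Set ℝ :=
  {x | ∃ (d : ℕ) (k : Fin d → ℕ), IsAdmissible k ∧ x = multipleZeta k}

/-- The algebra of multiple zeta values: the `ℚ`-subalgebra of `ℝ` generated by them. -/
noncomputable def mzvAlgebra : Subalgebra ℚ ℝ :=
  Algebra.adjoin ℚ mzvSet

/-- The set of multiple zeta values `ζ(k₁, …, k_d)` of weight `k₁ + ⋯ + k_d = w` and depth `d`. -/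
def mzvSetOf (w d : ℕ) : Set ℝ :=
  {x | ∃ k : Fin d → ℕ, IsAdmissible k ∧ ∑ i, k i = w ∧ x = multipleZeta k}

/-- The `ℚ`-linear span of the multiple zeta values of weight `w` and depth `d`. -/
noncomputable def mzvSpan (w d : ℕ) : Submodule ℚ ℝ :=
  Submodule.span ℚ (mzvSetOf w d)

/-- The term of the series at `(n₁, …, n_s)`:
`1 / (n₁ ^ k₁ ⋯ n_s ^ k_s (n₁ + ⋯ + n_s) ^ r)`. -/
noncomputable def seriesTerm {s : ℕ} (k : Fin s → ℕ) (r : ℕ) (n : Fin s → ℕ+) : ℝ :=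
  1 / ((∏ i, ((n i : ℕ) : ℝ) ^ k i) * (∑ i, ((n i : ℕ) : ℝ)) ^ r)

open scoped ENNReal

/-! Write `N = ∑ nᵢ`. Inserting `1 = ∑ⱼ nⱼ / N` turns the series into a sum of series of the same
weight, each with one `kⱼ` lowered by 1 and the power of `1/N` raised by 1 (`tornheimSum_eq_sum`).
Once some `kⱼ` reaches 0, summing over `nⱼ` replaces the function of `N` by its tail sum over
integers larger than the remaining total (`tornheimSum_eq_of_eq_zero`), which adds a new innermost
entry to a nested sum. When one variable is left, the series is itself a multiple zeta value.
Working in `ℝ≥0∞` makes every rearrangement free; convergence follows at the end from finiteness of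
the admissible nested sums. -/

/-- The sum of `∏ nᵢ ^ (-kᵢ)` over all `N < n₁ < ⋯ < n_d`, in the extended nonnegative reals. -/
noncomputable def nestedSum {d : ℕ} (k : Fin d → ℕ) (N : ℕ) : ℝ≥0∞ := by
  classical exact
  ∑' n : Fin d → ℕ+, if StrictMono n ∧ ∀ i, N < n i then ∏ i, (((n i : ℕ) : ℝ≥0∞)⁻¹) ^ k i else 0

/-- The sum of `∏ nᵢ ^ (-kᵢ) g(∑ nᵢ)` over all tuples of positive integers. -/
noncomputable def tornheimSum {m : ℕ} (k : Fin m → ℕ) (g : ℕ → ℝ≥0∞) : ℝ≥0∞ :=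
  ∑' n : Fin m → ℕ+, (∏ i, (((n i : ℕ) : ℝ≥0∞)⁻¹) ^ k i) * g (∑ i, (n i : ℕ))

/-! ### Recursion for nested sums -/

theorem tsum_pi_insertNth {d : ℕ} (j : Fin (d + 1)) (f : (Fin (d + 1) → ℕ+) → ℝ≥0∞) :
    ∑' n, f n = ∑' (a : ℕ+) (n : Fin d → ℕ+), f (j.insertNth a n) := by
  rw [← (Fin.insertNthEquiv (fun _ : Fin (d + 1) => ℕ+) j).tsum_eq, ENNReal.tsum_prod']
  rfl

theorem tsum_pi_cons {d : ℕ} (f : (Fin (d + 1) → ℕ+) → ℝ≥0∞) :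
    ∑' n, f n = ∑' (a : ℕ+) (n : Fin d → ℕ+), f (Fin.cons a n) := by
  simp only [tsum_pi_insertNth 0, Fin.insertNth_zero]
  rfl

theorem strictMono_cons_and_lt_iff {d : ℕ} (N : ℕ) (a : ℕ+) (n : Fin d → ℕ+) :
    (StrictMono (Fin.cons a n : Fin (d + 1) → ℕ+) ∧
      ∀ i, N < ((Fin.cons a n : Fin (d + 1) → ℕ+) i : ℕ)) ↔
    N < (a : ℕ) ∧ StrictMono n ∧ ∀ i, (a : ℕ) < n i := by
  constructor
  · rintro ⟨h1, h2⟩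
    refine ⟨by simpa using h2 0, fun i j hij => ?_, fun i => ?_⟩
    · simpa using h1 (Fin.succ_lt_succ_iff.2 hij)
    · simpa using h1 (Fin.succ_pos i)
  · rintro ⟨h1, h2, h3⟩
    refine ⟨fun i j => ?_, fun i => ?_⟩
    · refine Fin.cases ?_ (fun i => ?_) i <;> refine Fin.cases ?_ (fun j => ?_) j
      · simp
      · intro _
        simpa using h3 j
      · simp
      · intro hij
        simpa using h2 (Fin.succ_lt_succ_iff.1 hij)
    · refine Fin.cases ?_ (fun i => ?_) i
      · simpa using h1
      · simpa using h1.trans (h3 i)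

theorem tsum_ite_lt_eq_tsum_add (f : ℕ → ℝ≥0∞) (N : ℕ) :
    ∑' a : ℕ+, (if N < (a : ℕ) then f a else 0) = ∑' m : ℕ+, f (N + m) := by
  classical
  have hinj : Function.Injective (fun m : ℕ+ => (show ℕ+ from ⟨N + m, by positivity⟩)) := by
    intro a b h
    have := congrArg PNat.val h
    simp at this
    exact this
  rw [← hinj.tsum_eq (f := fun a : ℕ+ => if N < (a : ℕ) then f a else 0)]
  · refine tsum_congr fun m => ?_
    simp
  · intro a ha
    have hN : N < (a : ℕ) := by
      by_contra h
      simp [h] at ha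
    exact ⟨⟨a - N, by omega⟩, PNat.eq (by simp; omega)⟩

theorem nestedSum_cons {d : ℕ} (a : ℕ) (k : Fin d → ℕ) (N : ℕ) :
    nestedSum (Fin.cons a k : Fin (d + 1) → ℕ) N =
      ∑' m : ℕ+, (((N + m : ℕ) : ℝ≥0∞)⁻¹) ^ a * nestedSum k (N + m) := by
  classical
  rw [← tsum_ite_lt_eq_tsum_add (fun n => ((n : ℝ≥0∞)⁻¹) ^ a * nestedSum k n), nestedSum,
    tsum_pi_cons]
  refine tsum_congr fun b => ?_
  by_cases hb : N < (b : ℕ)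
  · rw [if_pos hb, nestedSum, ← ENNReal.tsum_mul_left]
    refine tsum_congr fun n => ?_
    simp only [strictMono_cons_and_lt_iff, hb, true_and, mul_ite, mul_zero,
      Fin.prod_univ_succ, Fin.cons_zero, Fin.cons_succ]
  · simp [strictMono_cons_and_lt_iff, hb]

theorem nestedSum_of_isEmpty (k : Fin 0 → ℕ) (N : ℕ) : nestedSum k N = 1 := by
  simp [nestedSum, Subsingleton.strictMono]

/-! ### Reduction to multiple zeta values -/

theorem tornheimSum_eq_sum {m : ℕ} (hm : 0 < m) (k : Fin m → ℕ) (hk : ∀ i, 1 ≤ k i)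
    (g : ℕ → ℝ≥0∞) :
    tornheimSum k g =
      ∑ j, tornheimSum (Function.update k j (k j - 1)) (fun N => (N : ℝ≥0∞)⁻¹ * g N) := by
  simp only [tornheimSum]
  rw [← Summable.tsum_finsetSum (fun _ _ => ENNReal.summable)]
  refine tsum_congr fun n => ?_
  have key : ∀ j, ∏ i, (((n i : ℕ) : ℝ≥0∞)⁻¹) ^ (Function.update k j (k j - 1) i) =
      (n j : ℕ) * ∏ i, (((n i : ℕ) : ℝ≥0∞)⁻¹) ^ k i := by
    intro j
    rw [← Finset.mul_prod_erase _ _ (Finset.mem_univ j),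
      ← Finset.mul_prod_erase Finset.univ (fun i => (((n i : ℕ) : ℝ≥0∞)⁻¹) ^ k i)
        (Finset.mem_univ j), ← mul_assoc]
    congr 1
    · obtain ⟨c, hc⟩ := Nat.exists_eq_add_of_le' (hk j)
      rw [Function.update_self, hc, Nat.add_sub_cancel, pow_succ', ← mul_assoc,
        ENNReal.mul_inv_cancel (by simp) (by simp), one_mul]
    · refine Finset.prod_congr rfl fun i hi => ?_
      rw [Function.update_of_ne (Finset.ne_of_mem_erase hi)]
  have hpos : (∑ i, (n i : ℕ)) ≠ 0 := by
    have := Finset.single_le_sum (f := fun i => (n i : ℕ)) (fun _ _ => Nat.zero_le _)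
      (Finset.mem_univ (⟨0, hm⟩ : Fin m))
    have := (n ⟨0, hm⟩).pos
    grind
  simp only [key, mul_assoc]
  rw [← Finset.sum_mul, ← Nat.cast_sum, mul_left_comm _ (((∑ i, (n i : ℕ) : ℕ) : ℝ≥0∞)⁻¹),
    ← mul_assoc, ENNReal.mul_inv_cancel (by exact_mod_cast hpos) (by simp), one_mul]

theorem tornheimSum_eq_of_eq_zero {m : ℕ} (k : Fin (m + 1) → ℕ) (j : Fin (m + 1)) (hj : k j = 0)
    (g : ℕ → ℝ≥0∞) :
    tornheimSum k g =
      tornheimSum (fun i => k (j.succAbove i)) (fun N => ∑' a : ℕ+, g (N + a)) := by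
  simp only [tornheimSum]
  rw [tsum_pi_insertNth j, ENNReal.tsum_comm]
  refine tsum_congr fun n => ?_
  rw [← ENNReal.tsum_mul_left]
  refine tsum_congr fun a => ?_
  simp [Fin.prod_univ_succAbove _ j, Fin.sum_univ_succAbove _ j, hj,
    add_comm]

theorem tornheimSum_one (k : Fin 1 → ℕ) (g : ℕ → ℝ≥0∞) :
    tornheimSum k g = ∑' a : ℕ+, (((a : ℕ) : ℝ≥0∞)⁻¹) ^ k 0 * g a := by
  rw [tornheimSum, ← (Equiv.funUnique (Fin 1) ℕ+).symm.tsum_eq]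
  simp

theorem IsAdmissible.cons {d : ℕ} {k : Fin d → ℕ} {a : ℕ} (ha : 1 ≤ a)
    (h : (d = 0 ∧ 2 ≤ a) ∨ IsAdmissible k) :
    IsAdmissible (Fin.cons a k : Fin (d + 1) → ℕ) := by
  rcases h with ⟨rfl, h⟩ | ⟨h1, i, hi, h2⟩
  · refine ⟨fun i => ?_, 0, rfl, h⟩
    rw [Fin.fin_one_eq_zero i]
    exact ha
  · refine ⟨fun j => ?_, i.succ, by simp [hi], by simpa using h2⟩
    refine Fin.cases ?_ (fun j => ?_) j
    · simpa using ha
    · simpa using h1 j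

/-- The extended nonnegative reals that are sums of multiple zeta values of weight `w`
and depth `d`. -/
noncomputable def mzvSums (w d : ℕ) : AddSubmonoid ℝ≥0∞ :=
  AddSubmonoid.closure {x | ∃ k : Fin d → ℕ, IsAdmissible k ∧ ∑ i, k i = w ∧ x = nestedSum k 0}

/-- The factor `nestedSum L N` records the variables already summed out, so that the induction
closes: outer on the number of variables, inner on the total exponent `c`. Requiring `1 ≤ l` while
`L` is empty is what forces the last entry to be at least 2. -/
theorem tornheimSum_mem_mzvSums (m : ℕ) : ∀ (c d w e : ℕ) (k : Fin (m + 1) → ℕ) (l : ℕ)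
    (L : Fin d → ℕ), ∑ i, k i = c → (∀ i, 1 ≤ k i) → ((d = 0 ∧ 1 ≤ l) ∨ IsAdmissible L) →
    c + l + ∑ i, L i = w → m + 1 + d = e →
    tornheimSum k (fun N => ((N : ℝ≥0∞)⁻¹) ^ l * nestedSum L N) ∈ mzvSums w e := by
  induction m with
  | zero =>
    rintro c d w e k l L hc hk hL hw rfl
    have hk0 := hk 0
    rw [tornheimSum_one]
    refine AddSubmonoid.subset_closure ?_
    rw [Nat.zero_add, Nat.add_comm]
    refine ⟨Fin.cons (k 0 + l) L, ?_, ?_, ?_⟩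
    · exact IsAdmissible.cons (by omega) (hL.imp (fun h => ⟨h.1, by omega⟩) id)
    · simp only [Fin.sum_univ_succ, Fin.cons_zero, Fin.cons_succ]
      simp at hc
      omega
    · rw [nestedSum_cons]
      simp [pow_add, mul_assoc]
  | succ m ih =>
    intro c
    induction c with
    | zero =>
      intro d w e k l L hc hk
      have h0 := hk 0
      have := Finset.sum_eq_zero_iff.1 hc 0 (Finset.mem_univ _)
      omega
    | succ c ihc =>
      intro d w e k l L hc hk hL hw he
      rw [tornheimSum_eq_sum (Nat.succ_pos _) k hk]
      refine sum_mem fun j _ => ?_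
      have hsum : ∑ i, Function.update k j (k j - 1) i = c := by
        have h1 := Fin.sum_univ_succAbove k j
        have h2 := Fin.sum_univ_succAbove (Function.update k j (k j - 1)) j
        simp only [Function.update_self, ne_eq, Fin.succAbove_ne, not_false_eq_true,
          Function.update_of_ne] at h2
        have := hk j
        omega
      have hg : (fun N : ℕ => (N : ℝ≥0∞)⁻¹ * (((N : ℝ≥0∞)⁻¹) ^ l * nestedSum L N)) =
          fun N : ℕ => ((N : ℝ≥0∞)⁻¹) ^ (l + 1) * nestedSum L N := by
        funext N
        rw [pow_succ', mul_assoc]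
      rw [hg]
      by_cases hj : k j = 1
      · rw [tornheimSum_eq_of_eq_zero _ j (by simp [hj])]
        have hs : (fun N : ℕ => ∑' a : ℕ+, (((N + a : ℕ) : ℝ≥0∞)⁻¹) ^ (l + 1) *
            nestedSum L (N + a)) =
            fun N : ℕ => ((N : ℝ≥0∞)⁻¹) ^ 0 *
              nestedSum (Fin.cons (l + 1) L : Fin (d + 1) → ℕ) N := by
          funext N
          rw [nestedSum_cons, pow_zero, one_mul]
        rw [hs]
        -- The power of `1/N` is absorbed into the new entry `l + 1`, so it restarts at 0.
        refine ih _ (d + 1) w e _ 0 _ rfl (fun i => ?_) (Or.inr ?_) ?_ (by omega)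
        · simpa [Function.update_of_ne] using hk _
        · exact IsAdmissible.cons (by omega) (hL.imp (fun h => ⟨h.1, by omega⟩) id)
        · have h2 := Fin.sum_univ_succAbove (Function.update k j (k j - 1)) j
          rw [hsum, Function.update_self] at h2
          rw [Fin.sum_univ_succ (Fin.cons (l + 1) L : Fin (d + 1) → ℕ)]
          simp only [Fin.cons_zero, Fin.cons_succ]
          omega
      · refine ihc d w e _ (l + 1) L hsum (fun i => ?_) (hL.imp (fun h => ⟨h.1, by omega⟩) id)
          (by omega) he
        have := hk j
        by_cases hij : i = j
        · subst hij
          rw [Function.update_self]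
          omega
        · rw [Function.update_of_ne hij]
          exact hk i

/-! ### Convergence and return to the reals -/

theorem tsum_pi_prod (f : ℕ+ → ℝ≥0∞) (d : ℕ) :
    ∑' n : Fin d → ℕ+, ∏ i, f (n i) = (∑' a, f a) ^ d := by
  induction d with
  | zero => simp
  | succ d ih =>
    rw [tsum_pi_cons, pow_succ', ← ih, ← ENNReal.tsum_mul_right]
    refine tsum_congr fun a => ?_
    rw [← ENNReal.tsum_mul_left]
    simp [Fin.prod_univ_succ]

theorem tsum_pnat_rpow_ne_top {p : ℝ} (hp : 1 < p) :
    ∑' a : ℕ+, ENNReal.ofReal (((a : ℕ) : ℝ) ^ (-p)) ≠ ∞ := by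
  have h : Summable fun n : ℕ => (n : ℝ) ^ (-p) := Real.summable_nat_rpow.2 (by linarith)
  have h' : Summable fun a : ℕ+ => ((a : ℕ) : ℝ) ^ (-p) :=
    h.comp_injective PNat.coe_injective
  exact h'.tsum_ofReal_ne_top

/-- The last exponent supplies a spare factor `1/n_d`. Since every `nᵢ ≤ n_d`, it can be shared out
as `nᵢ ^ (-1/d)` to each variable, which bounds the nested sum by the `d`-th power of a convergent
series. -/
theorem IsAdmissible.prod_le {d : ℕ} {k : Fin d → ℕ} (hk : IsAdmissible k) {n : Fin d → ℕ+}
    (hn : StrictMono n) :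
    ∏ i, (((n i : ℕ) : ℝ)⁻¹) ^ k i ≤ ∏ i, ((n i : ℕ) : ℝ) ^ (-(1 + 1 / d : ℝ)) := by
  obtain ⟨h1, j, hj, h2⟩ := hk
  have hd : (0 : ℝ) < d := by
    have : 0 < d := by omega
    exact_mod_cast this
  have hn1 : ∀ i, (1 : ℝ) ≤ ((n i : ℕ) : ℝ) := fun i => by exact_mod_cast (n i).pos
  have hn0 : ∀ i, (0 : ℝ) < ((n i : ℕ) : ℝ) := fun i => zero_lt_one.trans_le (hn1 i)
  have hle : ∀ i, ((n i : ℕ) : ℝ) ≤ ((n j : ℕ) : ℝ) := fun i => by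
    have : n i ≤ n j := hn.monotone (by rw [Fin.le_def]; omega)
    exact_mod_cast this
  have step : ∏ i, (((n i : ℕ) : ℝ)⁻¹) ^ k i ≤ (∏ i, ((n i : ℕ) : ℝ)⁻¹) * ((n j : ℕ) : ℝ)⁻¹ := by
    rw [← Finset.mul_prod_erase _ _ (Finset.mem_univ j),
      ← Finset.mul_prod_erase Finset.univ (fun i => ((n i : ℕ) : ℝ)⁻¹) (Finset.mem_univ j),
      mul_right_comm]
    refine mul_le_mul ?_ ?_ (Finset.prod_nonneg fun i _ => by positivity) (by positivity)
    · rw [← sq]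
      exact pow_le_pow_of_le_one (by positivity) (inv_le_one_of_one_le₀ (hn1 j)) h2
    · refine Finset.prod_le_prod (fun i _ => by positivity) fun i _ => ?_
      exact pow_le_of_le_one (by positivity) (inv_le_one_of_one_le₀ (hn1 i))
        (by have := h1 i; omega)
  have hpow : ((n j : ℕ) : ℝ)⁻¹ ≤ ∏ i, ((n i : ℕ) : ℝ) ^ (-(1 / d : ℝ)) := by
    calc ((n j : ℕ) : ℝ)⁻¹ = ∏ _i : Fin d, ((n j : ℕ) : ℝ) ^ (-(1 / d : ℝ)) := by
          rw [Finset.prod_const, Finset.card_univ, Fintype.card_fin, ← Real.rpow_natCast,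
            ← Real.rpow_mul (hn0 j).le, ← Real.rpow_neg_one]
          congr 1
          field_simp
      _ ≤ _ := Finset.prod_le_prod (fun i _ => by positivity) fun i _ =>
          Real.rpow_le_rpow_of_nonpos (hn0 i) (hle i) (by simp)
  refine step.trans ((mul_le_mul_of_nonneg_left hpow
    (Finset.prod_nonneg fun i _ => by positivity)).trans_eq ?_)
  rw [← Finset.prod_mul_distrib]
  refine Finset.prod_congr rfl fun i _ => ?_
  rw [neg_add, Real.rpow_add (hn0 i), Real.rpow_neg_one]

theorem ofReal_prod_inv_pow {d : ℕ} (k : Fin d → ℕ) (n : Fin d → ℕ+) :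
    ENNReal.ofReal (∏ i, (((n i : ℕ) : ℝ)⁻¹) ^ k i) =
      ∏ i, (((n i : ℕ) : ℝ≥0∞)⁻¹) ^ k i := by
  rw [ENNReal.ofReal_prod_of_nonneg fun i _ => by positivity]
  refine Finset.prod_congr rfl fun i _ => ?_
  rw [ENNReal.ofReal_pow (by positivity),
    ENNReal.ofReal_inv_of_pos (by exact_mod_cast (n i).pos), ENNReal.ofReal_natCast]

theorem IsAdmissible.nestedSum_ne_top {d : ℕ} {k : Fin d → ℕ} (hk : IsAdmissible k) (N : ℕ) :
    nestedSum k N ≠ ∞ := by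
  classical
  have hd : (0 : ℝ) < d := by
    obtain ⟨-, j, hj, -⟩ := hk
    have : 0 < d := by omega
    exact_mod_cast this
  refine ne_top_of_le_ne_top (ENNReal.pow_ne_top
    (tsum_pnat_rpow_ne_top (p := 1 + 1 / d) (by simpa using hd)) (n := d)) ?_
  rw [← tsum_pi_prod]
  refine ENNReal.tsum_le_tsum fun n => ?_
  split_ifs with h
  · rw [← ofReal_prod_inv_pow, ← ENNReal.ofReal_prod_of_nonneg fun i _ => by positivity]
    exact ENNReal.ofReal_le_ofReal (hk.prod_le h.1)
  · exact zero_le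

theorem multipleZeta_eq_toReal {d : ℕ} (k : Fin d → ℕ) :
    multipleZeta k = (nestedSum k 0).toReal := by
  classical
  have h : nestedSum k 0 = ∑' n : {n : Fin d → ℕ+ // StrictMono n},
      ∏ i, (((n.1 i : ℕ) : ℝ≥0∞)⁻¹) ^ k i := by
    rw [nestedSum]
    refine Eq.trans ?_ (tsum_subtype {n : Fin d → ℕ+ | StrictMono n}
      (fun n => ∏ i, (((n i : ℕ) : ℝ≥0∞)⁻¹) ^ k i)).symm
    refine tsum_congr fun n => ?_
    simp [Set.indicator_apply]
  rw [h, ENNReal.tsum_toReal_eq fun n => by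
    rw [← ofReal_prod_inv_pow]; exact ENNReal.ofReal_ne_top]
  refine tsum_congr fun n => ?_
  rw [← ofReal_prod_inv_pow,
    ENNReal.toReal_ofReal (Finset.prod_nonneg fun i _ => by positivity)]
  simp

theorem ne_top_and_toReal_mem_mzvSpan {w d : ℕ} {x : ℝ≥0∞} (hx : x ∈ mzvSums w d) :
    x ≠ ∞ ∧ x.toReal ∈ mzvSpan w d := by
  induction hx using AddSubmonoid.closure_induction with
  | mem x hx =>
    obtain ⟨k, hk, hw, rfl⟩ := hx
    exact ⟨hk.nestedSum_ne_top 0, Submodule.subset_span ⟨k, hk, hw, (multipleZeta_eq_toReal k).symm⟩⟩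
  | zero => simp
  | add x y _ _ hx hy =>
    refine ⟨ENNReal.add_ne_top.2 ⟨hx.1, hy.1⟩, ?_⟩
    rw [ENNReal.toReal_add hx.1 hy.1]
    exact add_mem hx.2 hy.2

theorem mzvSpan_le_mzvAlgebra (w d : ℕ) : mzvSpan w d ≤ Subalgebra.toSubmodule mzvAlgebra := by
  refine Submodule.span_le.2 ?_
  rintro x ⟨k, hk, -, rfl⟩
  exact Algebra.subset_adjoin ⟨d, k, hk, rfl⟩

theorem ofReal_seriesTerm {s : ℕ} (hs : 1 ≤ s) (k : Fin s → ℕ) (r : ℕ) (n : Fin s → ℕ+) :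
    ENNReal.ofReal (seriesTerm k r n) =
      (∏ i, (((n i : ℕ) : ℝ≥0∞)⁻¹) ^ k i) * (((∑ i, (n i : ℕ) : ℕ) : ℝ≥0∞)⁻¹) ^ r := by
  have hpos : (0 : ℝ) < ((∑ i, (n i : ℕ) : ℕ) : ℝ) := by
    rw [Nat.cast_sum]
    exact Finset.sum_pos (fun i _ => by exact_mod_cast (n i).pos) ⟨⟨0, hs⟩, Finset.mem_univ _⟩
  have h : seriesTerm k r n =
      (∏ i, (((n i : ℕ) : ℝ)⁻¹) ^ k i) * (((∑ i, (n i : ℕ) : ℕ) : ℝ)⁻¹) ^ r := by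
    simp [seriesTerm, mul_comm]
  rw [h, ENNReal.ofReal_mul (Finset.prod_nonneg fun i _ => by positivity), ofReal_prod_inv_pow,
    ENNReal.ofReal_pow (by positivity), ENNReal.ofReal_inv_of_pos hpos, ENNReal.ofReal_natCast]

theorem corollary4p4 (r s : ℕ) (hr : 1 ≤ r) (hs : 1 ≤ s) (k : Fin s → ℕ) (hk : ∀ i, 1 ≤ k i) :
    Summable (fun n : Fin s → ℕ+ => seriesTerm k r n) ∧
      (∑' n : Fin s → ℕ+, seriesTerm k r n) ∈ mzvAlgebra ∧
      (∑' n : Fin s → ℕ+, seriesTerm k r n) ∈ mzvSpan ((∑ i, k i) + r) s := by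
  have hnonneg : ∀ n, 0 ≤ seriesTerm k r n := fun n => by
    rw [seriesTerm]
    positivity
  have hmem : ∑' n : Fin s → ℕ+, ENNReal.ofReal (seriesTerm k r n) ∈
      mzvSums ((∑ i, k i) + r) s := by
    simp only [ofReal_seriesTerm hs]
    obtain ⟨m, rfl⟩ := Nat.exists_eq_add_of_le' hs
    have := tornheimSum_mem_mzvSums m _ 0 ((∑ i, k i) + r) (m + 1) k r Fin.elim0 rfl hk
      (Or.inl ⟨rfl, hr⟩) (by simp) rfl
    simpa only [tornheimSum, nestedSum_of_isEmpty, mul_one] using this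
  obtain ⟨hfin, hspan⟩ := ne_top_and_toReal_mem_mzvSpan hmem
  have hval : (∑' n : Fin s → ℕ+, ENNReal.ofReal (seriesTerm k r n)).toReal =
      ∑' n : Fin s → ℕ+, seriesTerm k r n := by
    rw [ENNReal.tsum_toReal_eq fun n => ENNReal.ofReal_ne_top]
    exact tsum_congr fun n => ENNReal.toReal_ofReal (hnonneg n)
  rw [hval] at hspan
  refine ⟨?_, mzvSpan_le_mzvAlgebra _ _ hspan, hspan⟩
  exact (ENNReal.summable_toReal hfin).congr fun n => ENNReal.toReal_ofReal (hnonneg n)
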